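/- Let $N\ge 1$ be an integer, let $1<p<\infty$, and let $q\in(p,\infty]$ be such that $q<p^*$ if $p\le N$ (no further restriction, i.e. $p<q\le\infty$, if $p>N$), where $p^*=\frac{Np}{N-p}$ if $p<N$ and $p^*=\infty$ if $p=N$. For an open set $\Omega\subset\mathbb{R}^N$ let $R_\Omega\in[0,\infty]$ be its inradius, that is, the supremum of the radii of the open balls contained in $\Omega$ (with $R_\emptyset=0$), and let $$\lambda_{p,q}(\Omega)=\inf_{u\in C_0^\infty(\Omega)\setminus\{0\}}\frac{\displaystyle\int_\Omega|\nabla u|^p\,dx}{\|u\|_{L^q(\Omega)}^p}\in[0,\infty],$$ where $C_0^\infty(\Omega)$ is the set of real-valued smooth functions on $\mathbb{R}^N$ with compact support contained in $\Omega$, and $\inf\emptyset=+\infty$. (For $q<\infty$ the denominator is $\left(\int_\Omega|u|^q\,dx\right)^{p/q}$; for $q=\infty$ it is the $p$-th power of the essential supremum of $|u|$.) Then there exists a constant $C=C(N,p,q)>0$ such that for every open convex set $\Omega\subset\mathbb{R}^N$, $$\lambda_{p,q}(\Omega)\ \ge\ \frac{C}{R_\Omega^{\,N\frac pq-N+p}},$$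 where $\frac pq=0$ if $q=\infty$, and the right-hand side is read as $0$ if $R_\Omega=\infty$ and as $+\infty$ if $R_\Omega=0$ (note that the exponent $N\frac pq-N+p$ is positive). -/

import Mathlib

open MeasureTheory
open scoped ENNReal NNReal ContDiff

/-- The inradius of `Ω`: the supremum of the radii of the open balls contained in `Ω`,
as an extended nonnegative number (`⊤` if `Ω` contains arbitrarily large balls, `0` if `Ω = ∅`). -/
noncomputable def inradius {N : ℕ} (Ω : Set (EuclideanSpace ℝ (Fin N))) : ℝ≥0∞ :=
  ⨆ (x : EuclideanSpace ℝ (Fin N)) (r : ℝ≥0) (_ : Metric.ball x (r : ℝ) ⊆ Ω), (r : ℝ≥0∞)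

/-- `u ∈ C₀^∞(Ω)`: a real-valued smooth function on `ℝ^N` whose support is compact and
contained in `Ω`. -/
structure IsTestFunction {N : ℕ} (Ω : Set (EuclideanSpace ℝ (Fin N)))
    (u : EuclideanSpace ℝ (Fin N) → ℝ) : Prop where
  contDiff : ContDiff ℝ ∞ u
  hasCompactSupport : HasCompactSupport u
  tsupport_subset : tsupport u ⊆ Ω

/-- The principal frequency `λ_{p,q}(Ω)`: the infimum of
`(∫_Ω |∇u|^p dx) / ‖u‖_{L^q(Ω)}^p` over all `u ∈ C₀^∞(Ω) ∖ {0}`.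
For `q < ∞` the denominator is `(∫_Ω |u|^q dx)^(p/q)`, and for `q = ∞` the `L^q` norm is the
essential supremum of `|u|`. The infimum over the empty family (`Ω = ∅`) is `⊤`. -/
noncomputable def principalFrequency {N : ℕ} (p : ℝ) (q : ℝ≥0∞)
    (Ω : Set (EuclideanSpace ℝ (Fin N))) : ℝ≥0∞ :=
  ⨅ (u : EuclideanSpace ℝ (Fin N) → ℝ) (_ : IsTestFunction Ω u) (_ : u ≠ 0),
    (∫⁻ x in Ω, ‖gradient u x‖ₑ ^ p) / (eLpNorm u q (volume.restrict Ω)) ^ p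

/-- The Sobolev exponent `p^*`: `N p / (N - p)` if `p < N`, and `∞` otherwise. -/
noncomputable def sobolevExponent (N : ℕ) (p : ℝ) : ℝ≥0∞ :=
  if p < N then ENNReal.ofReal ((N : ℝ) * p / ((N : ℝ) - p)) else ⊤

/-! Let `Ω` be convex and contain no ball of radius `r`. For each `x`, some point of `ball x r` lies
outside `Ω`, and a hyperplane through it separates it from `Ω`. Hence a fixed fraction of `ball x (2
* r)` misses `Ω` (`measure_unitBall_le_mul_measure_compl`). Averaging `u x = u x - u y` over those
missing points `y` bounds `|u x|` by `r` times the integral over `t ∈ (0, 1)` of averages of `|∇u|`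
on balls of radius `2 * r * t` about `x` (`enorm_mul_measure_le_lintegral_ballIntegral`).

In dimension `d`, averaging at scale `s` maps `L^p` to `L^q` with norm at most a constant times `s ^
(-d (1/p - 1/q))`. Subcriticality of `q` says `d (1/p - 1/q) < 1`, so this is integrable in `t` near
`0` (`exists_eLpNorm_lintegral_ballIntegral_le`). The result is a Poincaré–Sobolev inequality with
the scaling power of `r`; taking `r` to be twice the inradius and raising to the power `p` gives the
theorem. -/

section Holder

variable {E : Type*} [NormedAddCommGroup E] [NormedSpace ℝ E] [MeasurableSpace E] [BorelSpace E]

/-- The integral of `f` over the unit ball, centred at `x` and dilated by `s`. -/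
noncomputable def ballIntegral (μ : Measure E) (f : E → ℝ≥0∞) (x : E) (s : ℝ) : ℝ≥0∞ :=
  ∫⁻ v in Metric.ball (0 : E) 1, f (x + s • v) ∂μ

/-- Hölder's inequality for integrals over balls. -/
lemma ballIntegral_le_rpow [SecondCountableTopology E] {μ : Measure E} {f : E → ℝ≥0∞} {p : ℝ} (hp : 1 < p) (hf : Measurable f) (x : E) (s : ℝ) :
    ballIntegral μ f x s ≤
      ballIntegral μ (fun y ↦ f y ^ p) x s ^ (1 / p) * μ (Metric.ball 0 1) ^ (1 - 1 / p) := by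
  have h := ENNReal.lintegral_mul_le_Lp_mul_Lq (μ.restrict (Metric.ball 0 1))
    (Real.HolderConjugate.conjExponent hp) (f := fun v ↦ f (x + s • v)) (g := 1)
    (by fun_prop) (by fun_prop)
  have he : 1 / p.conjExponent = 1 - 1 / p := by
    have := (Real.HolderConjugate.conjExponent hp).inv_add_inv_eq_one
    simp only [one_div]; linarith
  simpa [he, ballIntegral] using h

end Holder

/-! ### Complement density, and bounds for ball integrals at a fixed scale. -/

section BallIntegral

variable {E : Type*} [NormedAddCommGroup E] [NormedSpace ℝ E] [MeasurableSpace E] [BorelSpace E]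
  [FiniteDimensional ℝ E] (μ : Measure E) [μ.IsAddHaarMeasure]

/-- The part of the unit ball in a closed half-space through the centre has at least half of the
measure of the ball. -/
lemma measure_unitBall_le_two_mul_halfBall (φ : StrongDual ℝ E) :
    μ (Metric.ball 0 1) ≤ 2 * μ {w ∈ Metric.ball (0 : E) 1 | 0 ≤ φ w} := by
  set A := {w ∈ Metric.ball (0 : E) 1 | 0 ≤ φ w}
  have hcover : Metric.ball (0 : E) 1 ⊆ A ∪ -A := by
    intro w hw
    rcases le_total 0 (φ w) with h | h
    · exact Or.inl ⟨hw, h⟩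
    · refine Or.inr ⟨?_, ?_⟩
      · simpa using hw
      · simpa using h
  calc μ (Metric.ball 0 1) ≤ μ A + μ (-A) := (measure_mono hcover).trans (measure_union_le _ _)
    _ = 2 * μ A := by rw [Measure.measure_neg, two_mul]

open scoped Pointwise in
/-- Around each point of a convex open set, the complement has a definite density at a scale
at which the set contains no ball centred at this point. -/
lemma measure_unitBall_le_mul_measure_compl {Ω : Set E} (hΩ : IsOpen Ω) (hconv : Convex ℝ Ω)
    {x : E} {r : ℝ} (hr : 0 < r) (hball : ¬ Metric.ball x r ⊆ Ω) :
    μ (Metric.ball 0 1) ≤ 2 ^ (Module.finrank ℝ E + 1) *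
      μ {v ∈ Metric.ball (0 : E) 1 | x + (2 * r) • v ∉ Ω} := by
  obtain ⟨z, hzx, hz⟩ := Set.not_subset.mp hball
  obtain ⟨φ, hφ⟩ := geometric_hahn_banach_open_point hconv hΩ hz
  set A := {w ∈ Metric.ball (0 : E) 1 | 0 ≤ φ w}
  set S := {v ∈ Metric.ball (0 : E) 1 | x + (2 * r) • v ∉ Ω}
  -- `y` is the missing point `z` in the coordinates `v ↦ x + (2 * r) • v`. Since `‖y‖ < 1/2`, the
  -- half-size copy of the half-ball `A` attached at `y` stays in the unit ball. It stays outside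
  -- `Ω` because `φ ≥ φ z` there.
  set y : E := (2 * r)⁻¹ • (z - x)
  have hy : ‖y‖ < 2⁻¹ := by
    rw [mem_ball_iff_norm] at hzx
    rw [norm_smul, Real.norm_of_nonneg (by positivity), mul_inv, mul_assoc]
    have : r⁻¹ * ‖z - x‖ < 1 := by rw [inv_mul_lt_iff₀ hr]; simpa using hzx
    linarith
  have hsub : (fun v ↦ y + v) '' ((2⁻¹ : ℝ) • A) ⊆ S := by
    rintro _ ⟨_, ⟨w, ⟨hw, hφw⟩, rfl⟩, rfl⟩
    refine ⟨?_, fun hmem ↦ ?_⟩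
    · rw [mem_ball_zero_iff] at hw ⊢
      calc ‖y + (2⁻¹ : ℝ) • w‖ ≤ ‖y‖ + ‖(2⁻¹ : ℝ) • w‖ := norm_add_le _ _
        _ < 1 := by rw [norm_smul (2⁻¹ : ℝ) w, Real.norm_of_nonneg (by norm_num)]; linarith
    · have h := hφ _ hmem
      have heq : x + (2 * r) • (y + (2⁻¹ : ℝ) • w) = z + r • w := by
        rw [smul_add, smul_smul, smul_smul, mul_inv_cancel₀ (by positivity), one_smul,
          show 2 * r * 2⁻¹ = r by ring]
        abel
      simp only [heq, map_add, map_smul, smul_eq_mul] at h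
      have := mul_nonneg hr.le hφw
      linarith
  have hle : ENNReal.ofReal |(2⁻¹ : ℝ) ^ Module.finrank ℝ E| * μ A ≤ μ S := by
    rw [← Measure.addHaar_smul, ← measure_preimage_add μ (-y), ← Set.image_add_left]
    exact measure_mono hsub
  calc μ (Metric.ball 0 1) ≤ 2 * μ A := measure_unitBall_le_two_mul_halfBall μ φ
    _ = 2 ^ (Module.finrank ℝ E + 1) *
        (ENNReal.ofReal |(2⁻¹ : ℝ) ^ Module.finrank ℝ E| * μ A) := by
      rw [abs_of_pos (by positivity), ENNReal.ofReal_pow (by norm_num),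
        ENNReal.ofReal_inv_of_pos two_pos, pow_succ', ← mul_assoc, mul_assoc 2, ← mul_pow,
        ENNReal.ofReal_ofNat, ENNReal.mul_inv_cancel (by norm_num) (by norm_num), one_pow, mul_one]
    _ ≤ _ := by gcongr

variable {μ} {f : E → ℝ≥0∞}

lemma measurable_ballIntegral (hf : Measurable f) :
    Measurable fun a : E × ℝ ↦ ballIntegral μ f a.1 a.2 := by
  unfold ballIntegral
  exact Measurable.lintegral_prod_right' (f := fun b : (E × ℝ) × E ↦ f (b.1.1 + b.1.2 • b.2))
    (by fun_prop)

lemma lintegral_ballIntegral (hf : Measurable f) (s : ℝ) :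
    ∫⁻ x, ballIntegral μ f x s ∂μ = μ (Metric.ball 0 1) * ∫⁻ x, f x ∂μ := by
  unfold ballIntegral
  rw [lintegral_lintegral_swap (by fun_prop)]
  simp_rw [lintegral_add_right_eq_self f]
  simp [mul_comm]

/-- The `L^1` to `L^∞` bound: enlarge the ball to the whole space and change variables; the Jacobian
gives `s ^ (-d)`. -/
lemma ballIntegral_le (hf : Measurable f) (x : E) {s : ℝ} (hs : 0 < s) :
    ballIntegral μ f x s ≤ ENNReal.ofReal s ^ (-(Module.finrank ℝ E : ℝ)) * ∫⁻ x, f x ∂μ := by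
  calc ballIntegral μ f x s ≤ ∫⁻ v, f (x + s • v) ∂μ := setLIntegral_le_lintegral _ _
    _ = ∫⁻ w, f (x + w) ∂(μ.map (s • ·)) := by
      rw [lintegral_map (by fun_prop) (by fun_prop)]
    _ = ENNReal.ofReal s ^ (-(Module.finrank ℝ E : ℝ)) * ∫⁻ x, f x ∂μ := by
      rw [Measure.map_addHaar_smul _ hs.ne', lintegral_smul_measure, lintegral_add_left_eq_self,
        abs_of_pos (by positivity), ENNReal.ofReal_inv_of_pos (by positivity), ENNReal.rpow_neg,
        ENNReal.ofReal_pow hs.le, ENNReal.rpow_natCast, smul_eq_mul]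

/-- The integral over balls of radius `s` maps `L^p` to `L^q`. -/
lemma lintegral_ballIntegral_rpow_le {p q : ℝ} (hp : 1 < p) (hpq : p < q) (hf : Measurable f)
    {s : ℝ} (hs : 0 < s) :
    ∫⁻ x, ballIntegral μ f x s ^ q ∂μ ≤
      μ (Metric.ball 0 1) ^ (q * (1 - 1 / p) + 1) *
        (ENNReal.ofReal s ^ (-(Module.finrank ℝ E * (q / p - 1))) *
          (∫⁻ x, f x ^ p ∂μ) ^ (q / p)) := by
  set V := μ (Metric.ball (0 : E) 1)
  set I := ∫⁻ x, f x ^ p ∂μ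
  set F : E → ℝ≥0∞ := fun x ↦ ballIntegral μ (fun y ↦ f y ^ p) x s
  have hp0 : 0 < p := by linarith
  have hq0 : 0 < q := by linarith
  have hqp : 0 < q / p - 1 := by rw [sub_pos, one_lt_div hp0]; exact hpq
  -- After Hölder, `F ^ (q / p)` splits as `F ^ (q / p - 1) * F`: the first factor is bounded
  -- uniformly in `x`, the second will be integrated exactly by Fubini.
  have hpt (x : E) : ballIntegral μ f x s ^ q ≤
      V ^ (q * (1 - 1 / p)) *
        (ENNReal.ofReal s ^ (-(Module.finrank ℝ E : ℝ)) * I) ^ (q / p - 1) * F x := by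
    calc ballIntegral μ f x s ^ q ≤ (F x ^ (1 / p) * V ^ (1 - 1 / p)) ^ q := by
          gcongr; exact ballIntegral_le_rpow hp hf x s
      _ = V ^ (q * (1 - 1 / p)) * F x ^ (q / p - 1) * F x := by
          rw [ENNReal.mul_rpow_of_nonneg _ _ hq0.le, ← ENNReal.rpow_mul, ← ENNReal.rpow_mul,
            mul_comm, mul_comm q, mul_assoc]
          congr 1
          nth_rw 3 [← ENNReal.rpow_one (F x)]
          rw [← ENNReal.rpow_add_of_nonneg _ _ hqp.le zero_le_one]
          congr 1; ring
      _ ≤ _ := by gcongr; exact ballIntegral_le (by fun_prop) x hs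
  calc ∫⁻ x, ballIntegral μ f x s ^ q ∂μ
      ≤ ∫⁻ x, V ^ (q * (1 - 1 / p)) *
        (ENNReal.ofReal s ^ (-(Module.finrank ℝ E : ℝ)) * I) ^ (q / p - 1) * F x ∂μ :=
        lintegral_mono hpt
    _ = V ^ (q * (1 - 1 / p)) *
        (ENNReal.ofReal s ^ (-(Module.finrank ℝ E : ℝ)) * I) ^ (q / p - 1) * (V * I) := by
        rw [lintegral_const_mul, lintegral_ballIntegral (by fun_prop)]
        exact (measurable_ballIntegral (hf.pow_const p)).comp measurable_prodMk_right
    _ = _ := by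
        have hV : V ^ (q * (1 - 1 / p) + 1) = V ^ (q * (1 - 1 / p)) * V := by
          rw [ENNReal.rpow_add_of_nonneg _ _ _ zero_le_one, ENNReal.rpow_one]
          have : 1 / p < 1 := by rw [div_lt_one hp0]; exact hp
          have : 0 < 1 - 1 / p := by linarith
          positivity
        have hI : I ^ (q / p) = I ^ (q / p - 1) * I := by
          conv_rhs => rw [← ENNReal.rpow_one I, ← ENNReal.rpow_mul, one_mul,
            ← ENNReal.rpow_add_of_nonneg _ _ hqp.le zero_le_one]
          congr 1; ring
        rw [hV, hI, ENNReal.mul_rpow_of_nonneg _ _ hqp.le, ← ENNReal.rpow_mul, neg_mul]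
        ring

end BallIntegral

/-! ### Power weights on the unit interval. -/

lemma lintegral_Ioo_ofReal_rpow_ne_top {a : ℝ} (ha : -1 < a) :
    ∫⁻ t in Set.Ioo (0 : ℝ) 1, ENNReal.ofReal t ^ a ≠ ⊤ := by
  have h := ((intervalIntegral.integrableOn_Ioo_rpow_iff one_pos).mpr ha).lintegral_lt_top.ne
  rwa [setLIntegral_congr_fun (g := fun t ↦ ENNReal.ofReal t ^ a) measurableSet_Ioo] at h
  intro t ht
  exact (ENNReal.ofReal_rpow_of_pos ht.1).symm

/-- A weighted form of Hölder's inequality on the unit interval. -/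
lemma exists_lintegral_Ioo_rpow_le {q γ : ℝ} (hq : 1 < q) (hγ : γ < q - 1) :
    ∃ M : ℝ≥0∞, M ≠ ⊤ ∧ ∀ h : ℝ → ℝ≥0∞, Measurable h →
      (∫⁻ t in Set.Ioo (0 : ℝ) 1, h t) ^ q ≤
        M * ∫⁻ t in Set.Ioo (0 : ℝ) 1, h t ^ q * ENNReal.ofReal t ^ γ := by
  have hq0 : 0 < q := by linarith
  have hconj := Real.HolderConjugate.conjExponent hq
  -- The conjugate power of the weight is `t ^ (-γ / (q - 1))`, integrable at `0` because `γ < q -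
  -- 1`.
  have hexp : -1 < -(γ / q) * q.conjExponent := by
    rw [Real.conjExponent, neg_mul, neg_lt_neg_iff, div_mul_div_comm, mul_comm q,
      mul_div_mul_right _ _ hq0.ne', div_lt_one (by linarith)]
    exact hγ
  refine ⟨((∫⁻ t in Set.Ioo (0 : ℝ) 1,
    ENNReal.ofReal t ^ (-(γ / q) * q.conjExponent)) ^ (1 / q.conjExponent)) ^ q, ?_, ?_⟩
  · have := hconj.symm.pos
    exact ENNReal.rpow_ne_top_of_nonneg hq0.le (ENNReal.rpow_ne_top_of_nonneg (by positivity)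
      (lintegral_Ioo_ofReal_rpow_ne_top hexp))
  intro h hh
  have key := ENNReal.lintegral_mul_le_Lp_mul_Lq (volume.restrict (Set.Ioo (0 : ℝ) 1)) hconj
    (f := fun t ↦ h t * ENNReal.ofReal t ^ (γ / q))
    (g := fun t ↦ ENNReal.ofReal t ^ (-(γ / q))) (by fun_prop) (by fun_prop)
  have hleft : ∫⁻ t in Set.Ioo (0 : ℝ) 1, h t = ∫⁻ t in Set.Ioo (0 : ℝ) 1,
      ((fun t ↦ h t * ENNReal.ofReal t ^ (γ / q)) *
        fun t ↦ ENNReal.ofReal t ^ (-(γ / q))) t := by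
    refine setLIntegral_congr_fun measurableSet_Ioo fun t ht ↦ ?_
    have ht0 : ENNReal.ofReal t ≠ 0 := by simpa using ht.1
    simp only [Pi.mul_apply]
    rw [mul_assoc, ← ENNReal.rpow_add _ _ ht0 ENNReal.ofReal_ne_top, add_neg_cancel,
      ENNReal.rpow_zero, mul_one]
  rw [← hleft] at key
  calc (∫⁻ t in Set.Ioo (0 : ℝ) 1, h t) ^ q ≤ _ := ENNReal.rpow_le_rpow key hq0.le
    _ = _ := by
      rw [ENNReal.mul_rpow_of_nonneg _ _ hq0.le, ← ENNReal.rpow_mul, one_div_mul_cancel hq0.ne',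
        ENNReal.rpow_one, mul_comm]
      simp_rw [ENNReal.mul_rpow_of_nonneg _ _ hq0.le, ← ENNReal.rpow_mul,
        div_mul_cancel₀ _ hq0.ne']

/-! ### Integration over all scales below `ρ`. -/

section Averaging

variable {E : Type*} [NormedAddCommGroup E] [NormedSpace ℝ E] [MeasurableSpace E] [BorelSpace E]
  [FiniteDimensional ℝ E] (μ : Measure E) [μ.IsAddHaarMeasure]

/-- The endpoint `q = ∞`: each scale is bounded pointwise by a multiple of `t ^ (-d / p)`,
integrable since `d / p < 1`. -/
lemma exists_lintegral_ballIntegral_le {p : ℝ} (hp : 1 < p)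
    (hd : (Module.finrank ℝ E : ℝ) / p < 1) :
    ∃ K : ℝ≥0∞, K ≠ ⊤ ∧ ∀ (f : E → ℝ≥0∞) (ρ : ℝ) (x : E), Measurable f → 0 < ρ →
      ∫⁻ t in Set.Ioo (0 : ℝ) 1, ballIntegral μ f x (t * ρ) ≤
        K * ENNReal.ofReal ρ ^ (-((Module.finrank ℝ E : ℝ) / p)) *
          (∫⁻ y, f y ^ p ∂μ) ^ (1 / p) := by
  set δ : ℝ := (Module.finrank ℝ E : ℝ) / p with hδ
  set V := μ (Metric.ball (0 : E) 1)
  have hp0 : 0 < p := by linarith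
  have hp1 : 0 ≤ 1 - 1 / p := by
    rw [sub_nonneg, div_le_one hp0]; exact hp.le
  refine ⟨V ^ (1 - 1 / p) * ∫⁻ t in Set.Ioo (0 : ℝ) 1, ENNReal.ofReal t ^ (-δ),
    ENNReal.mul_ne_top (ENNReal.rpow_ne_top_of_nonneg hp1 measure_ball_lt_top.ne)
      (lintegral_Ioo_ofReal_rpow_ne_top (by linarith)), fun f ρ x hf hρ ↦ ?_⟩
  set I := ∫⁻ y, f y ^ p ∂μ
  calc ∫⁻ t in Set.Ioo (0 : ℝ) 1, ballIntegral μ f x (t * ρ)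
      ≤ ∫⁻ t in Set.Ioo (0 : ℝ) 1,
        V ^ (1 - 1 / p) * ENNReal.ofReal ρ ^ (-δ) * I ^ (1 / p) * ENNReal.ofReal t ^ (-δ) := by
        refine setLIntegral_mono' measurableSet_Ioo fun t ht ↦ ?_
        have ht0 : 0 < t := ht.1
        calc ballIntegral μ f x (t * ρ)
            ≤ (ENNReal.ofReal (t * ρ) ^ (-(Module.finrank ℝ E : ℝ)) * I) ^ (1 / p)
              * V ^ (1 - 1 / p) := by
              refine (ballIntegral_le_rpow hp hf x _).trans ?_
              gcongr
              exact ballIntegral_le (hf.pow_const p) x (by positivity)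
          _ = _ := by
              rw [ENNReal.mul_rpow_of_nonneg _ _ (by positivity), ← ENNReal.rpow_mul,
                show -(Module.finrank ℝ E : ℝ) * (1 / p) = -δ by rw [hδ]; ring,
                ENNReal.ofReal_mul ht0.le,
                ENNReal.mul_rpow_of_ne_top ENNReal.ofReal_ne_top ENNReal.ofReal_ne_top]
              ring
    _ = _ := by
        rw [lintegral_const_mul _ (by fun_prop)]
        ring

/-- For finite `q`, a weighted Hölder inequality in `t` brings the power `q` inside the scale
integral; Fubini then reduces to the fixed-scale bound, which costs `t ^ (-κ)`. -/
lemma exists_lintegral_lintegral_ballIntegral_rpow_le {p q : ℝ} (hp : 1 < p) (hpq : p < q)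
    (hd : (Module.finrank ℝ E : ℝ) * (1 / p - 1 / q) < 1) :
    ∃ K : ℝ≥0∞, K ≠ ⊤ ∧ ∀ (f : E → ℝ≥0∞) (ρ : ℝ), Measurable f → 0 < ρ →
      ∫⁻ x, (∫⁻ t in Set.Ioo (0 : ℝ) 1, ballIntegral μ f x (t * ρ)) ^ q ∂μ ≤
        K * ENNReal.ofReal ρ ^ (-(Module.finrank ℝ E * (q / p - 1))) *
          (∫⁻ y, f y ^ p ∂μ) ^ (q / p) := by
  set κ : ℝ := Module.finrank ℝ E * (q / p - 1) with hκ
  set V := μ (Metric.ball (0 : E) 1)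
  have hp0 : 0 < p := by linarith
  have hq0 : 0 < q := by linarith
  have hκq : κ < q := by
    have := mul_lt_mul_of_pos_left hd hq0
    calc κ = q * ((Module.finrank ℝ E : ℝ) * (1 / p - 1 / q)) := by rw [hκ]; field_simp
      _ < q := by linarith
  have hp1 : 0 ≤ 1 - 1 / p := by
    rw [sub_nonneg, div_le_one hp0]; exact hp.le
  -- The weight exponent needs `γ < q - 1` for Hölder and `γ - κ > -1` for the remaining integral.
  -- The midpoint of `κ - 1` and `q - 1` satisfies both because `κ < q`.
  obtain ⟨M, hM, hMle⟩ := exists_lintegral_Ioo_rpow_le (q := q) (γ := (κ + q) / 2 - 1)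
    (hp.trans hpq) (by linarith)
  set γ := (κ + q) / 2 - 1 with hγ
  refine ⟨M * V ^ (q * (1 - 1 / p) + 1) * ∫⁻ t in Set.Ioo (0 : ℝ) 1, ENNReal.ofReal t ^ (γ - κ),
    ENNReal.mul_ne_top (ENNReal.mul_ne_top hM
      (ENNReal.rpow_ne_top_of_nonneg (by positivity) measure_ball_lt_top.ne))
      (lintegral_Ioo_ofReal_rpow_ne_top (by linarith)), fun f ρ hf hρ ↦ ?_⟩
  set I := ∫⁻ y, f y ^ p ∂μ
  have hmeas : Measurable fun a : E × ℝ ↦ ballIntegral μ f a.1 (a.2 * ρ) :=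
    (measurable_ballIntegral hf).comp (by fun_prop : Measurable fun a : E × ℝ ↦ (a.1, a.2 * ρ))
  have hmeas_right (x : E) : Measurable fun t ↦ ballIntegral μ f x (t * ρ) :=
    hmeas.comp measurable_prodMk_left
  have hmeas_left (t : ℝ) : Measurable fun x ↦ ballIntegral μ f x (t * ρ) :=
    hmeas.comp measurable_prodMk_right
  have hmeas_weight : Measurable fun a : E × ℝ ↦
      ballIntegral μ f a.1 (a.2 * ρ) ^ q * ENNReal.ofReal a.2 ^ γ :=
    (hmeas.pow_const q).mul (by fun_prop)
  calc ∫⁻ x, (∫⁻ t in Set.Ioo (0 : ℝ) 1, ballIntegral μ f x (t * ρ)) ^ q ∂μ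
      ≤ ∫⁻ x, M * (∫⁻ t in Set.Ioo (0 : ℝ) 1,
          ballIntegral μ f x (t * ρ) ^ q * ENNReal.ofReal t ^ γ) ∂μ :=
        lintegral_mono fun x ↦ hMle _ (hmeas_right x)
    _ = M * ∫⁻ t in Set.Ioo (0 : ℝ) 1,
          (∫⁻ x, ballIntegral μ f x (t * ρ) ^ q ∂μ) * ENNReal.ofReal t ^ γ := by
        rw [lintegral_const_mul _ hmeas_weight.lintegral_prod_right',
          lintegral_lintegral_swap hmeas_weight.aemeasurable]
        congr 1
        refine lintegral_congr fun t ↦ ?_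
        dsimp only
        rw [lintegral_mul_const _ ((hmeas_left t).pow_const q)]
    _ ≤ M * ∫⁻ t in Set.Ioo (0 : ℝ) 1, V ^ (q * (1 - 1 / p) + 1) *
          ENNReal.ofReal ρ ^ (-κ) * I ^ (q / p) * ENNReal.ofReal t ^ (γ - κ) := by
        gcongr M * ?_
        refine setLIntegral_mono' measurableSet_Ioo fun t ht ↦ ?_
        have ht0 : 0 < t := ht.1
        have ht0' : ENNReal.ofReal t ≠ 0 := by simpa using ht0
        calc _ ≤ V ^ (q * (1 - 1 / p) + 1) * (ENNReal.ofReal (t * ρ) ^ (-κ) * I ^ (q / p)) *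
              ENNReal.ofReal t ^ γ := by
              gcongr
              exact lintegral_ballIntegral_rpow_le hp hpq hf (by positivity)
          _ = _ := by
              rw [ENNReal.ofReal_mul ht0.le,
                ENNReal.mul_rpow_of_ne_top ENNReal.ofReal_ne_top ENNReal.ofReal_ne_top,
                sub_eq_add_neg γ κ, ENNReal.rpow_add _ _ ht0' ENNReal.ofReal_ne_top]
              ring
    _ = _ := by
        rw [lintegral_const_mul _ (by fun_prop)]
        ring

/-- A fractional integration estimate: averaging the ball integrals over the scales below `ρ`
maps `L^p` to `L^q` as long as `q` is subcritical. -/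
lemma exists_eLpNorm_lintegral_ballIntegral_le {p : ℝ} {q : ℝ≥0∞} (hp : 1 < p)
    (hpq : ENNReal.ofReal p < q)
    (hd : (Module.finrank ℝ E : ℝ) * (1 / p - q⁻¹.toReal) < 1) :
    ∃ K : ℝ≥0∞, K ≠ ⊤ ∧ ∀ (f : E → ℝ≥0∞) (ρ : ℝ), Measurable f → 0 < ρ →
      eLpNorm (fun x ↦ ∫⁻ t in Set.Ioo (0 : ℝ) 1, ballIntegral μ f x (t * ρ)) q μ ≤
        K * ENNReal.ofReal ρ ^ (-(Module.finrank ℝ E * (1 / p - q⁻¹.toReal))) *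
          (∫⁻ y, f y ^ p ∂μ) ^ (1 / p) := by
  have hp0 : 0 < p := by linarith
  rcases eq_or_ne q ⊤ with rfl | hq
  · have he : (Module.finrank ℝ E : ℝ) * (1 / p - (⊤ : ℝ≥0∞)⁻¹.toReal) =
      (Module.finrank ℝ E : ℝ) / p := by simp [div_eq_mul_inv]
    rw [he] at hd ⊢
    obtain ⟨K, hK, hle⟩ := exists_lintegral_ballIntegral_le μ hp hd
    refine ⟨K, hK, fun f ρ hf hρ ↦ ?_⟩
    rw [eLpNorm_exponent_top]
    exact essSup_le_of_ae_le _ (.of_forall fun x ↦ hle f ρ x hf hρ)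
  · lift q to ℝ≥0 using hq
    have hpq' : p < (q : ℝ) := by
      rwa [← ENNReal.ofReal_coe_nnreal, ENNReal.ofReal_lt_ofReal_iff_of_nonneg hp0.le] at hpq
    have hq0 : (0 : ℝ) < q := by linarith
    have hq0' : q ≠ 0 := by rintro rfl; simp at hq0
    have he : (q : ℝ≥0∞)⁻¹.toReal = 1 / (q : ℝ) := by simp
    rw [he] at hd ⊢
    obtain ⟨K, hK, hle⟩ := exists_lintegral_lintegral_ballIntegral_rpow_le μ hp hpq' hd
    refine ⟨K ^ (1 / (q : ℝ)), ENNReal.rpow_ne_top_of_nonneg (by positivity) hK,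
      fun f ρ hf hρ ↦ ?_⟩
    rw [eLpNorm_nnreal_eq_lintegral hq0']
    refine (ENNReal.rpow_le_rpow (hle f ρ hf hρ) (by positivity)).trans_eq ?_
    have hscale : -(Module.finrank ℝ E * ((q : ℝ) / p - 1)) * (1 / (q : ℝ)) =
        -(Module.finrank ℝ E * (1 / p - 1 / (q : ℝ))) := by field_simp
    rw [ENNReal.mul_rpow_of_nonneg _ _ (by positivity),
      ENNReal.mul_rpow_of_nonneg _ _ (by positivity), ← ENNReal.rpow_mul, ← ENNReal.rpow_mul,
      hscale, div_mul_div_comm, mul_one, mul_comm p, ← div_div, div_self hq0.ne']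

end Averaging

/-! ### From complement density to the Poincaré–Sobolev inequality. -/

section Poincare

variable {E : Type*} [NormedAddCommGroup E] [NormedSpace ℝ E]

lemma enorm_sub_le_lintegral_fderiv {u : E → ℝ} (hu : ContDiff ℝ 1 u) (x y : E) :
    ‖u (x + y) - u x‖ₑ ≤ ‖y‖ₑ * ∫⁻ t in Set.Ioo (0 : ℝ) 1, ‖fderiv ℝ u (x + t • y)‖ₑ := by
  have hderiv (t : ℝ) : HasDerivAt (fun t : ℝ ↦ u (x + t • y)) (fderiv ℝ u (x + t • y) y) t := by
    have h1 : HasDerivAt (fun t : ℝ ↦ x + t • y) y t := by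
      simpa using ((hasDerivAt_id t).smul_const y).const_add x
    exact ((hu.differentiable one_ne_zero).differentiableAt.hasFDerivAt).comp_hasDerivAt t h1
  have hcont : Continuous fun t : ℝ ↦ fderiv ℝ u (x + t • y) :=
    (hu.continuous_fderiv one_ne_zero).comp (by fun_prop)
  have hint := intervalIntegral.integral_eq_sub_of_hasDerivAt (a := 0) (b := 1)
    (fun t _ ↦ hderiv t) ((hcont.clm_apply continuous_const).intervalIntegrable _ _)
  simp only [one_smul, zero_smul, add_zero] at hint
  rw [← hint, intervalIntegral.integral_of_le zero_le_one, integral_Ioc_eq_integral_Ioo]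
  calc ‖∫ t in Set.Ioo (0 : ℝ) 1, fderiv ℝ u (x + t • y) y‖ₑ
      ≤ ∫⁻ t in Set.Ioo (0 : ℝ) 1, ‖fderiv ℝ u (x + t • y) y‖ₑ :=
        enorm_integral_le_lintegral_enorm _
    _ ≤ ∫⁻ t in Set.Ioo (0 : ℝ) 1, ‖y‖ₑ * ‖fderiv ℝ u (x + t • y)‖ₑ := by
        refine lintegral_mono fun t ↦ ?_
        rw [mul_comm]
        exact ContinuousLinearMap.le_opENorm _ _
    _ = _ := lintegral_const_mul' _ _ (by simp)

variable [MeasurableSpace E] [BorelSpace E] [FiniteDimensional ℝ E] (μ : Measure E)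
  [μ.IsAddHaarMeasure]

/-- A function vanishing outside a convex open set which contains no ball of radius `r` is
controlled by the averages of its derivative at the scales below `2 * r`. -/
lemma enorm_mul_measure_le_lintegral_ballIntegral {Ω : Set E} (hΩ : IsOpen Ω)
    (hconv : Convex ℝ Ω) {r : ℝ} (hr : 0 < r) {u : E → ℝ} (hu : ContDiff ℝ 1 u)
    (hzero : ∀ x ∉ Ω, u x = 0) (hball : ∀ x, ¬ Metric.ball x r ⊆ Ω) (x : E) :
    ‖u x‖ₑ * μ (Metric.ball 0 1) ≤ 2 ^ (Module.finrank ℝ E + 1) * (ENNReal.ofReal (2 * r) *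
      ∫⁻ t in Set.Ioo (0 : ℝ) 1,
        ballIntegral μ (fun y ↦ ‖fderiv ℝ u y‖ₑ) x (t * (2 * r))) := by
  set S := {v ∈ Metric.ball (0 : E) 1 | x + (2 * r) • v ∉ Ω}
  have hS : MeasurableSet S := by
    refine Metric.isOpen_ball.measurableSet.inter ?_
    exact (hΩ.measurableSet.preimage
      (by fun_prop : Measurable fun v : E ↦ x + (2 * r) • v)).compl
  have hcont := hu.continuous_fderiv one_ne_zero
  -- Integrate the derivative along the segment from `x` to a point where `u` vanishes.
  have hpt (v : E) (hv : v ∈ S) : ‖u x‖ₑ ≤ ENNReal.ofReal (2 * r) *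
      ∫⁻ t in Set.Ioo (0 : ℝ) 1, ‖fderiv ℝ u (x + (t * (2 * r)) • v)‖ₑ := by
    have h := enorm_sub_le_lintegral_fderiv hu x ((2 * r) • v)
    rw [hzero _ hv.2, zero_sub, enorm_neg, enorm_smul, Real.enorm_of_nonneg (r := 2 * r) (by positivity)] at h
    simp_rw [smul_smul] at h
    refine h.trans ?_
    gcongr
    refine mul_le_of_le_one_right' ?_
    rw [← ofReal_norm]
    exact ENNReal.ofReal_le_one.mpr (mem_ball_zero_iff.mp hv.1).le
  have hmeas : Measurable fun a : E × ℝ ↦ ‖fderiv ℝ u (x + (a.2 * (2 * r)) • a.1)‖ₑ :=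
    (hcont.comp (by fun_prop)).enorm.measurable
  calc ‖u x‖ₑ * μ (Metric.ball 0 1) ≤ ‖u x‖ₑ * (2 ^ (Module.finrank ℝ E + 1) * μ S) := by
        gcongr
        exact measure_unitBall_le_mul_measure_compl μ hΩ hconv hr (hball x)
    _ = 2 ^ (Module.finrank ℝ E + 1) * ∫⁻ v in S, ‖u x‖ₑ ∂μ := by
        rw [setLIntegral_const]; ring
    _ ≤ 2 ^ (Module.finrank ℝ E + 1) * ∫⁻ v in S, ENNReal.ofReal (2 * r) *
          (∫⁻ t in Set.Ioo (0 : ℝ) 1, ‖fderiv ℝ u (x + (t * (2 * r)) • v)‖ₑ) ∂μ := by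
        gcongr 2 ^ (Module.finrank ℝ E + 1) * ?_
        exact setLIntegral_mono' hS hpt
    _ ≤ 2 ^ (Module.finrank ℝ E + 1) * ∫⁻ v in Metric.ball 0 1, ENNReal.ofReal (2 * r) *
          (∫⁻ t in Set.Ioo (0 : ℝ) 1, ‖fderiv ℝ u (x + (t * (2 * r)) • v)‖ₑ) ∂μ := by
        gcongr
        exact Set.sep_subset _ _
    _ = _ := by
        rw [lintegral_const_mul _ hmeas.lintegral_prod_right',
          lintegral_lintegral_swap hmeas.aemeasurable]
        rfl

/-- The Poincaré–Sobolev inequality for functions vanishing outside a convex open set which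
contains no ball of radius `r`, with an explicit dependence on `r`. -/
lemma exists_eLpNorm_le_of_convex {p : ℝ} {q : ℝ≥0∞} (hp : 1 < p) (hpq : ENNReal.ofReal p < q)
    (hd : (Module.finrank ℝ E : ℝ) * (1 / p - q⁻¹.toReal) < 1) :
    ∃ K : ℝ≥0∞, K ≠ ⊤ ∧ ∀ (Ω : Set E) (r : ℝ) (u : E → ℝ), IsOpen Ω → Convex ℝ Ω → 0 < r →
      ContDiff ℝ 1 u → (∀ x ∉ Ω, u x = 0) → (∀ x, ¬ Metric.ball x r ⊆ Ω) →
      eLpNorm u q μ ≤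
        K * ENNReal.ofReal (2 * r) ^ (1 - Module.finrank ℝ E * (1 / p - q⁻¹.toReal)) *
          (∫⁻ y, ‖fderiv ℝ u y‖ₑ ^ p ∂μ) ^ (1 / p) := by
  obtain ⟨K, hK, hle⟩ := exists_eLpNorm_lintegral_ballIntegral_le μ hp hpq hd
  set V := μ (Metric.ball (0 : E) 1)
  have hV0 : V ≠ 0 := (Metric.measure_ball_pos μ _ one_pos).ne'
  have hV : V ≠ ⊤ := measure_ball_lt_top.ne
  have hc : (2 : ℝ≥0∞) ^ (Module.finrank ℝ E + 1) / V ≠ ⊤ :=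
    ENNReal.div_ne_top (by finiteness) hV0
  refine ⟨2 ^ (Module.finrank ℝ E + 1) / V * K, ENNReal.mul_ne_top hc hK,
    fun Ω r u hΩ hconv hr hu hzero hball ↦ ?_⟩
  set ρ := ENNReal.ofReal (2 * r)
  have hρ0 : ρ ≠ 0 := by simpa [ρ] using hr
  have hρ : ρ ≠ ⊤ := ENNReal.ofReal_ne_top
  set G : E → ℝ≥0∞ := fun x ↦ ∫⁻ t in Set.Ioo (0 : ℝ) 1,
    ballIntegral μ (fun y ↦ ‖fderiv ℝ u y‖ₑ) x (t * (2 * r))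
  have hpt (x : E) : ‖u x‖ₑ ≤ 2 ^ (Module.finrank ℝ E + 1) / V * ρ * G x := by
    have h := enorm_mul_measure_le_lintegral_ballIntegral μ hΩ hconv hr hu hzero hball x
    calc ‖u x‖ₑ ≤ 2 ^ (Module.finrank ℝ E + 1) * (ρ * G x) / V :=
          (ENNReal.le_div_iff_mul_le (.inl hV0) (.inl hV)).mpr h
      _ = _ := by simp only [div_eq_mul_inv]; ring
  set c : ℝ≥0 := (2 ^ (Module.finrank ℝ E + 1) / V * ρ).toNNReal
  have hcc : (c : ℝ≥0∞) = 2 ^ (Module.finrank ℝ E + 1) / V * ρ :=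
    ENNReal.coe_toNNReal (ENNReal.mul_ne_top hc hρ)
  calc eLpNorm u q μ ≤ c • eLpNorm G q μ :=
        eLpNorm_le_nnreal_smul_eLpNorm_of_ae_le_mul' (.of_forall fun x ↦ by
          rw [hcc]; exact hpt x) q
    _ = 2 ^ (Module.finrank ℝ E + 1) / V * ρ * eLpNorm G q μ := by
        rw [ENNReal.smul_def, hcc, smul_eq_mul]
    _ ≤ 2 ^ (Module.finrank ℝ E + 1) / V * ρ *
          (K * ρ ^ (-(Module.finrank ℝ E * (1 / p - q⁻¹.toReal))) *
          (∫⁻ y, ‖fderiv ℝ u y‖ₑ ^ p ∂μ) ^ (1 / p)) := by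
        gcongr
        exact hle _ _ (hu.continuous_fderiv one_ne_zero).enorm.measurable (by positivity)
    _ = _ := by
        rw [sub_eq_add_neg 1, ENNReal.rpow_add _ _ hρ0 hρ, ENNReal.rpow_one]
        ring

end Poincare

/-! ### Inradius, subcriticality and the main theorem. -/

lemma enorm_gradient {E : Type*} [NormedAddCommGroup E] [InnerProductSpace ℝ E] [CompleteSpace E]
    (u : E → ℝ) (x : E) : ‖gradient u x‖ₑ = ‖fderiv ℝ u x‖ₑ := by
  rw [← toDual_gradient]
  exact ((InnerProductSpace.toDual ℝ E).enorm_map _).symm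

lemma ofReal_le_inradius {N : ℕ} {Ω : Set (EuclideanSpace ℝ (Fin N))}
    {x : EuclideanSpace ℝ (Fin N)} {r : ℝ} (hr : 0 ≤ r) (h : Metric.ball x r ⊆ Ω) :
    ENNReal.ofReal r ≤ inradius Ω := by
  lift r to ℝ≥0 using hr
  rw [ENNReal.ofReal_coe_nnreal]
  exact le_iSup_of_le x (le_iSup₂_of_le r h le_rfl)

lemma inradius_pos {N : ℕ} {Ω : Set (EuclideanSpace ℝ (Fin N))} (hΩ : IsOpen Ω)
    (hne : Ω.Nonempty) : 0 < inradius Ω := by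
  obtain ⟨x, hx⟩ := hne
  obtain ⟨r, hr, hsub⟩ := Metric.isOpen_iff.mp hΩ x hx
  exact (ENNReal.ofReal_pos.mpr hr).trans_le (ofReal_le_inradius hr.le hsub)

/-- The subcriticality of `q` in terms of the scaling exponent. -/
lemma mul_one_div_sub_toReal_inv_lt_one {N : ℕ} {p : ℝ} {q : ℝ≥0∞} (hp : 1 < p)
    (hpq : ENNReal.ofReal p < q) (hq : p ≤ (N : ℝ) → q < sobolevExponent N p) :
    (N : ℝ) * (1 / p - q⁻¹.toReal) < 1 := by
  have hp0 : 0 < p := by linarith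
  have hq' : 0 ≤ q⁻¹.toReal := ENNReal.toReal_nonneg
  rcases lt_or_ge (N : ℝ) p with hN | hN
  · calc (N : ℝ) * (1 / p - q⁻¹.toReal) ≤ N * (1 / p) := by gcongr; linarith
      _ < 1 := by rw [mul_one_div, div_lt_one hp0]; exact hN
  have hN0 : (0 : ℝ) < N := by linarith
  have hlt := hq hN
  have hqtop : q ≠ ⊤ := hlt.ne_top
  lift q to ℝ≥0 using hqtop
  have hq0 : (0 : ℝ) < q := by
    have := (ENNReal.ofReal_pos.mpr hp0).trans hpq
    exact_mod_cast this
  rw [ENNReal.toReal_inv, ENNReal.coe_toReal]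
  suffices h : (N : ℝ) / p - 1 < N * (q : ℝ)⁻¹ by
    rw [mul_sub, mul_one_div]; linarith
  rcases hN.lt_or_eq with hN' | hN'
  · rw [sobolevExponent, if_pos hN', ← ENNReal.ofReal_coe_nnreal,
      ENNReal.ofReal_lt_ofReal_iff_of_nonneg hq0.le, lt_div_iff₀ (by linarith)] at hlt
    rw [← div_eq_mul_inv, lt_div_iff₀ hq0, div_sub_one hp0.ne', div_mul_eq_mul_div,
      div_lt_iff₀ hp0]
    linarith
  · rw [← hN', div_self hp0.ne', sub_self]
    positivity

theorem mainTheorem6 (N : ℕ) (hN : 1 ≤ N) (p : ℝ) (hp : 1 < p) (q : ℝ≥0∞)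
    (hpq : ENNReal.ofReal p < q) (hq : p ≤ (N : ℝ) → q < sobolevExponent N p) :
    ∃ C : ℝ, 0 < C ∧
      ∀ Ω : Set (EuclideanSpace ℝ (Fin N)), IsOpen Ω → Convex ℝ Ω →
        principalFrequency p q Ω ≥
          ENNReal.ofReal C / inradius Ω ^ ((N : ℝ) * p * (q⁻¹).toReal - (N : ℝ) + p) := by
  have hp0 : 0 < p := by linarith
  have hθ := mul_one_div_sub_toReal_inv_lt_one hp hpq hq
  set α := (N : ℝ) * p * (q⁻¹).toReal - (N : ℝ) + p
  have hα : (1 - (N : ℝ) * (1 / p - q⁻¹.toReal)) * p = α := by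
    simp only [α]; field_simp; ring
  have hα0 : 0 < α := by rw [← hα]; exact mul_pos (by linarith) hp0
  obtain ⟨K, hK, hle⟩ := exists_eLpNorm_le_of_convex
    (volume : Measure (EuclideanSpace ℝ (Fin N))) hp hpq
    (by rwa [finrank_euclideanSpace_fin])
  rw [finrank_euclideanSpace_fin] at hle
  -- The factor `4 ^ α` comes from the scale `2 * (2 * R)`; adding `1` keeps `D` nonzero even if `K
  -- = 0`, so that `D⁻¹` is finite.
  set D : ℝ≥0∞ := K ^ p * 4 ^ α + 1
  have hD : D ≠ ⊤ := ENNReal.add_ne_top.mpr ⟨ENNReal.mul_ne_top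
    (ENNReal.rpow_ne_top_of_nonneg hp0.le hK)
    (ENNReal.rpow_ne_top_of_nonneg hα0.le (by norm_num)), ENNReal.one_ne_top⟩
  have hD0 : D ≠ 0 := by simp [D]
  refine ⟨D⁻¹.toReal, ENNReal.toReal_pos (ENNReal.inv_ne_zero.mpr hD)
    (ENNReal.inv_ne_top.mpr hD0), fun Ω hΩ hconv ↦ ?_⟩
  rw [ENNReal.ofReal_toReal (ENNReal.inv_ne_top.mpr hD0)]
  refine le_iInf fun u ↦ le_iInf fun hu ↦ le_iInf fun hu0 ↦ ?_
  have hzero (x) (hx : x ∉ Ω) : u x = 0 :=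
    image_eq_zero_of_notMem_tsupport fun h ↦ hx (hu.tsupport_subset h)
  have hne : Ω.Nonempty := by
    obtain ⟨x, hx⟩ := Function.ne_iff.mp hu0
    exact ⟨x, by_contra fun h ↦ hx (hzero x h)⟩
  have hR0 := (inradius_pos hΩ hne).ne'
  rcases eq_or_ne (inradius Ω) ⊤ with hR | hR
  · simp [hR, ENNReal.top_rpow_of_pos hα0]
  set R := inradius Ω
  have hRpos : 0 < R.toReal := ENNReal.toReal_pos hR0 hR
  -- A ball of radius exactly `R` may fit in `Ω`; doubling makes the radius strictly larger than the
  -- inradius.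
  have hball (x) : ¬ Metric.ball x (2 * R.toReal) ⊆ Ω := by
    intro h
    have h1 := ENNReal.toReal_mono hR (ofReal_le_inradius (by positivity) h)
    rw [ENNReal.toReal_ofReal (by positivity)] at h1
    linarith
  have hcont : Continuous u := hu.contDiff.continuous
  have hsupp : Function.support u ⊆ Ω := (subset_tsupport u).trans hu.tsupport_subset
  have hLq : eLpNorm u q (volume.restrict Ω) = eLpNorm u q volume :=
    eLpNorm_restrict_eq_of_support_subset hsupp
  have hI : ∫⁻ x in Ω, ‖gradient u x‖ₑ ^ p = ∫⁻ x, ‖fderiv ℝ u x‖ₑ ^ p := by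
    simp_rw [enorm_gradient]
    refine setLIntegral_eq_of_support_subset fun x hx ↦ ?_
    refine hu.tsupport_subset (support_fderiv_subset ℝ fun h ↦ hx ?_)
    simp [h, hp0, ← ofReal_norm]
  have hfin : eLpNorm u q volume ≠ ⊤ :=
    (hcont.memLp_of_hasCompactSupport hu.hasCompactSupport).eLpNorm_ne_top
  have hq0 : q ≠ 0 := (zero_le.trans_lt hpq).ne'
  have hpos : eLpNorm u q volume ≠ 0 := by
    intro h
    rw [eLpNorm_eq_zero_iff hcont.aestronglyMeasurable hq0] at h
    exact hu0 ((hcont.ae_eq_iff_eq volume continuous_const).mp h)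
  have hmain := hle Ω (2 * R.toReal) u hΩ hconv (by positivity)
    (hu.contDiff.of_le (by exact_mod_cast le_top)) hzero hball
  have hρ : ENNReal.ofReal (2 * (2 * R.toReal)) = 4 * R := by
    rw [← mul_assoc, ENNReal.ofReal_mul (by norm_num), ENNReal.ofReal_toReal hR]
    norm_num
  have hpow := ENNReal.rpow_le_rpow hmain hp0.le
  rw [hρ, ENNReal.mul_rpow_of_nonneg _ _ hp0.le, ENNReal.mul_rpow_of_nonneg _ _ hp0.le,
    ← ENNReal.rpow_mul, ← ENNReal.rpow_mul, hα, one_div_mul_cancel hp0.ne', ENNReal.rpow_one,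
    ENNReal.mul_rpow_of_nonneg _ _ hα0.le] at hpow
  rw [hLq, hI, ENNReal.le_div_iff_mul_le (.inl (by simp [hpos, hfin]))
    (.inl (ENNReal.rpow_ne_top_of_nonneg hp0.le hfin))]
  have hRα0 : R ^ α ≠ 0 := by simp [hR0, hR]
  have hRα : R ^ α ≠ ⊤ := ENNReal.rpow_ne_top_of_nonneg hα0.le hR
  rw [div_eq_mul_inv, ← ENNReal.mul_inv (.inl hD0) (.inl hD), mul_comm, ← div_eq_mul_inv]
  refine ENNReal.div_le_of_le_mul ?_
  calc eLpNorm u q volume ^ p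
      ≤ K ^ p * (4 ^ α * R ^ α) * ∫⁻ x, ‖fderiv ℝ u x‖ₑ ^ p := hpow
    _ = (∫⁻ x, ‖fderiv ℝ u x‖ₑ ^ p) * (K ^ p * 4 ^ α * R ^ α) := by ring
    _ ≤ (∫⁻ x, ‖fderiv ℝ u x‖ₑ ^ p) * (D * R ^ α) := by
        gcongr
        exact le_self_add
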